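/- Let $K$ be any field and let $d\ge 3$ be an integer. Let $R=K[x_{d-1,0},x_{d-2,1},\dots,x_{0,d-1},y_1,y_2]$, and let $S=K_{\mathrm{DP}}[X_{d-1,0},X_{d-2,1},\dots,X_{0,d-1},Y_1,Y_2]$ be the divided power algebra, on which $R$ acts by contraction: a variable of $R$ lowers by one the exponent of the corresponding variable in a divided power monomial if that exponent is positive, and kills the monomial otherwise. For $G\in S$ put $\operatorname{Ann}_R(G)=\{f\in R: f\circ G=0\}$ and $A_G=R/\operatorname{Ann}_R(G)$; for homogeneous $G$ this is a graded algebra, with Hilbert function $h_t=\dim_K [A_G]_t$. Let $$F=\sum_{i=0}^{d-1}X_{d-1-i,i}\,Y_1^{d-1-i}Y_2^{i}\in S_d ,\qquad \ell=\sum_{i=0}^{d-1}a_{d-1-i,i}\,x_{d-1-i,i}\in R_1 \quad (a_{d-1-i,i}\in K),$$ where $X_{d-1-i,i}\,Y_1^{d-1-i}Y_2^{i}$ denotes the divided power monomial with these exponents. Set $r=\lfloor (d-1)/2\rfloor$ and let $s$ be the rank of the $(d-r)\times(r+1)$ Hankel matrix whose entry in row $i$ and column $j$ ($0\le i\le d-1-r$,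 $0\le j\le r$) is $a_{d-1-(i+j),\,i+j}$. Then the $h$-vector $(h_0,\dots,h_{d-1})$ of $A_{\ell\circ F}$ is $$(1,2,\dots,s-1,s,s,\dots,s,s,s-1,\dots,2,1),$$ that is, $h_t=t+1$ for $0\le t<s$, $h_t=s$ for $s-1\le t\le d-s$ (with $t\ge 0$), $h_t=d-t$ for $d-s\le t\le d-1$, and $h_t=0$ for $t\ge d$. (If $\ell=0$, then $s=0$ and $A_{\ell\circ F}=0$.) -/

import Mathlib

noncomputable section

namespace PerazzoJordan

/-- The space `S` underlying the divided power algebra `K_DP[X_i : i ∈ σ]`: finite `K`-linear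
combinations of the divided power monomials, which are indexed by their exponent vectors
`u : σ →₀ ℕ`. Only its structure of module under contraction is used, not its product. -/
def DividedPower (σ K : Type*) [Field K] : Type _ := (σ →₀ ℕ) →₀ K

namespace DividedPower

variable {σ K : Type*} [Field K]

instance : AddCommGroup (DividedPower σ K) := inferInstanceAs (AddCommGroup ((σ →₀ ℕ) →₀ K))

instance : Module K (DividedPower σ K) := inferInstanceAs (Module K ((σ →₀ ℕ) →₀ K))

/-- The divided power monomial with exponent vector `u`. -/
def monomial (u : σ →₀ ℕ) : DividedPower σ K := Finsupp.single u (1 : K)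

/-- The coefficient of the divided power monomial with exponent vector `u`. -/
def coeff (u : σ →₀ ℕ) (G : DividedPower σ K) : K := (show (σ →₀ ℕ) →₀ K from G) u

theorem ext {G H : DividedPower σ K} (h : ∀ u, coeff u G = coeff u H) : G = H :=
  Finsupp.ext h

/-- Contraction by the monomial `x^u`: the coefficient of `X^v` in `x^u ∘ G` is the coefficient
of `X^(u+v)` in `G`. -/
def contractMonomial (u : σ →₀ ℕ) : DividedPower σ K →ₗ[K] DividedPower σ K :=
  Finsupp.lcomapDomain (M := K) (R := K) (fun v : σ →₀ ℕ => u + v) (add_right_injective u)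

theorem coeff_contractMonomial (u v : σ →₀ ℕ) (G : DividedPower σ K) :
    coeff v (contractMonomial u G) = coeff (u + v) G := rfl

/-- Contraction by an arbitrary polynomial, extended `K`-linearly from monomials. -/
def contract (σ K : Type*) [Field K] :
    MvPolynomial σ K →ₐ[K] Module.End K (DividedPower σ K) :=
  AddMonoidAlgebra.lift K (Module.End K (DividedPower σ K)) (σ →₀ ℕ)
    { toFun := fun u => contractMonomial u.toAdd
      map_one' := LinearMap.ext fun G => ext fun v => by
        rw [coeff_contractMonomial, toAdd_one, zero_add]; rfl
      map_mul' := fun u w => LinearMap.ext fun G => ext fun v => by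
        rw [Module.End.mul_apply, coeff_contractMonomial, coeff_contractMonomial,
          coeff_contractMonomial, toAdd_mul, ← add_assoc, add_comm u.toAdd w.toAdd] }

/-- `S` is a module over the polynomial ring `R` through contraction; `f • G` is `f ∘ G`. -/
instance : Module (MvPolynomial σ K) (DividedPower σ K) :=
  Module.compHom (DividedPower σ K) (contract σ K).toRingHom

theorem smul_eq_contract (f : MvPolynomial σ K) (G : DividedPower σ K) :
    f • G = contract σ K f G := rfl

theorem coeff_monomial_smul (u v : σ →₀ ℕ) (c : K) (G : DividedPower σ K) :
    coeff v (MvPolynomial.monomial u c • G) = c * coeff (u + v) G := by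
  have h : contract σ K (MvPolynomial.monomial u c) = c • contractMonomial u :=
    AddMonoidAlgebra.lift_single _ _ _
  rw [smul_eq_contract, h]
  rfl

/-- The defining formula of contraction: `x_i` lowers the exponent of `X_i` by one if it is
positive, and kills the monomial otherwise. -/
theorem X_smul_monomial (i : σ) (u : σ →₀ ℕ) :
    (MvPolynomial.X i : MvPolynomial σ K) • (monomial u : DividedPower σ K) =
      if 0 < u i then monomial (u - Finsupp.single i 1) else 0 := by
  classical
  refine ext fun v => ?_
  rw [MvPolynomial.X, coeff_monomial_smul, one_mul]
  have key : coeff (Finsupp.single i 1 + v) (monomial u : DividedPower σ K) =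
      if u = Finsupp.single i 1 + v then 1 else 0 := Finsupp.single_apply
  rw [key]
  split_ifs with h1 h2 h2
  · subst h1
    rw [add_tsub_cancel_left]
    exact (Finsupp.single_eq_same).symm
  · exact absurd (by rw [h1]; simp) h2
  · refine (Finsupp.single_eq_of_ne ?_).symm
    rintro rfl
    refine h1 ?_
    rw [add_tsub_cancel_of_le]
    exact Finsupp.single_le_iff.2 h2
  · rfl

end DividedPower

/-- `A_G = R / Ann_R(G)`, where `Ann_R(G) = {f ∈ R : f ∘ G = 0}`. -/
abbrev MacaulayAlgebra {σ K : Type*} [Field K] (G : DividedPower σ K) : Type _ :=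
  MvPolynomial σ K ⧸ Ideal.torsionOf (MvPolynomial σ K) (DividedPower σ K) G

/-- The degree `t` component of `A_G`: the image of the forms of degree `t`. -/
def gradedPiece {σ K : Type*} [Field K] (G : DividedPower σ K) (t : ℕ) :
    Submodule K (MacaulayAlgebra G) :=
  (MvPolynomial.homogeneousSubmodule σ K t).map
    (Ideal.Quotient.mkₐ K
      (Ideal.torsionOf (MvPolynomial σ K) (DividedPower σ K) G)).toLinearMap

/-- The Hilbert function of `A_G`. -/
def hilbertFunction {σ K : Type*} [Field K] (G : DividedPower σ K) (t : ℕ) : ℕ :=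
  Module.finrank K (gradedPiece G t)

/-- The variables for `m = 2`: `Sum.inl i` stands for the index of `x_{d-1-i,i}`
(for `0 ≤ i ≤ d-1`), and `Sum.inr 0`, `Sum.inr 1` for the indices of `y_1`, `y_2`. -/
abbrev Var (d : ℕ) : Type := Fin d ⊕ Fin 2

/-- The full Perazzo form `F = ∑ X_{d-1-i,i} Y_1^{d-1-i} Y_2^i` for `m = 2`. -/
def perazzoForm (K : Type*) [Field K] (d : ℕ) : DividedPower (Var d) K :=
  ∑ i : Fin d, DividedPower.monomial
    (Finsupp.single (Sum.inl i) 1 + Finsupp.single (Sum.inr 0) (d - 1 - (i : ℕ))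
      + Finsupp.single (Sum.inr 1) (i : ℕ))

/-- The linear form `ℓ = ∑ a_{d-1-i,i} x_{d-1-i,i}`; here `a i` stands for `a_{d-1-i,i}`. -/
def linearForm {K : Type*} [Field K] {d : ℕ} (a : Fin d → K) : MvPolynomial (Var d) K :=
  ∑ i : Fin d, MvPolynomial.C (a i) * MvPolynomial.X (Sum.inl i)

/-- The `(d-r) × (r+1)` Hankel (catalecticant) matrix, with entry `a_{d-1-(i+j), i+j}` in row `i`
and column `j` (counted from `0`). -/
def hankelMatrix {K : Type*} {d : ℕ} (a : Fin d → K) (r : ℕ) :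
    Matrix (Fin (d - r)) (Fin (r + 1)) K :=
  Matrix.of fun i j => a ⟨(i : ℕ) + (j : ℕ), by omega⟩

end PerazzoJordan

end

/-! Each `x_i` occurs in exactly one monomial of `F`, so `ℓ ∘ F` is the binary form with
coefficients `a`, of degree `d - 1` in `Y₁, Y₂`. Its contractions by forms of degree `t` are spanned
by the columns of a Hankel matrix of size `(d - t) × (t + 1)`, whence `h_t` is the rank of that
matrix (`hilbertFunction_eq_rank_hankel`).

Transposition gives `h_t = h_{d-1-t}`, and counting columns gives `h_t ≤ t + 1`. The essential input
is `rank_hankel_succ_le`: once `h_t ≤ t`, the sequence no longer increases. Reading kernel vectors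
as polynomials `f`, the next kernel contains both `f` and `z f`; a rank increase would make the
nonzero kernel stable under multiplication by `z` in bounded degree, which is absurd. These three
facts determine the sequence from its middle value `s` (`symmetric_sequence_shape`). -/

noncomputable section

namespace PerazzoJordan

/-! ### Ranks and kernels of Hankel matrices -/

section Hankel

/-- The `k × l` Hankel matrix of a sequence `b`. -/
def hankel {K : Type*} (b : ℕ → K) (k l : ℕ) : Matrix (Fin k) (Fin l) K :=
  Matrix.of fun i j => b ((i : ℕ) + (j : ℕ))

theorem hankel_transpose {K : Type*} (b : ℕ → K) (k l : ℕ) :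
    (hankel b k l).transpose = hankel b l k := by
  ext i j
  simp [hankel, add_comm]

variable {K : Type*} [Field K]

theorem rank_hankel_comm (b : ℕ → K) (k l : ℕ) :
    (hankel b k l).rank = (hankel b l k).rank := by
  rw [← hankel_transpose, Matrix.rank_transpose]

theorem mem_ker_hankel {b : ℕ → K} {k l : ℕ} {v : Fin l → K} :
    v ∈ LinearMap.ker (hankel b k l).mulVecLin ↔
      ∀ i < k, ∑ j : Fin l, b (i + j) * v j = 0 := by
  rw [LinearMap.mem_ker, Matrix.mulVecLin_apply]
  constructor
  · intro h i hi
    exact congrFun h ⟨i, hi⟩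
  · intro h
    ext i
    exact h i i.2

theorem rank_hankel_add_finrank_ker (b : ℕ → K) (k l : ℕ) :
    (hankel b k l).rank + Module.finrank K (LinearMap.ker (hankel b k l).mulVecLin) = l := by
  have h := LinearMap.finrank_range_add_finrank_ker (hankel b k l).mulVecLin
  rwa [Module.finrank_fin_fun] at h

/-- Appending a zero entry at the end of a vector. -/
def snocZero (K : Type*) [Field K] (l : ℕ) : (Fin l → K) →ₗ[K] (Fin (l + 1) → K) where
  toFun v := Fin.snoc v 0
  map_add' v w := by
    ext i
    refine Fin.lastCases ?_ (fun j => ?_) i <;> simp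
  map_smul' c v := by
    ext i
    refine Fin.lastCases ?_ (fun j => ?_) i <;> simp

theorem snocZero_apply {l : ℕ} (v : Fin l → K) : snocZero K l v = Fin.snoc v 0 := rfl

theorem snocZero_injective (l : ℕ) : Function.Injective (snocZero K l) := by
  intro v w h
  ext i
  have := congrFun h i.castSucc
  simpa [snocZero_apply] using this

theorem snocZero_mem_ker {b : ℕ → K} {k l : ℕ} {v : Fin l → K}
    (hv : v ∈ LinearMap.ker (hankel b (k + 1) l).mulVecLin) :
    snocZero K l v ∈ LinearMap.ker (hankel b k (l + 1)).mulVecLin := by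
  rw [mem_ker_hankel] at hv ⊢
  intro i hi
  rw [Fin.sum_univ_castSucc]
  simpa [snocZero_apply] using hv i (by omega)

/-- The shift absorbs one index of the Hankel sequence: row `i` on the shifted vector is row `i + 1`
on the original, which is why a row is lost. -/
theorem cons_zero_mem_ker {b : ℕ → K} {k l : ℕ} {v : Fin l → K}
    (hv : v ∈ LinearMap.ker (hankel b (k + 1) l).mulVecLin) :
    (Fin.cons 0 v : Fin (l + 1) → K) ∈ LinearMap.ker (hankel b k (l + 1)).mulVecLin := by
  rw [mem_ker_hankel] at hv ⊢
  intro i hi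
  rw [Fin.sum_univ_succ]
  simpa [add_assoc, add_comm, add_left_comm] using hv (i + 1) (by omega)

/-- A space of vectors stable under the truncated shift with vanishing overflow is zero. -/
theorem eq_zero_of_shift_mem {l : ℕ} {V : Submodule K (Fin l → K)}
    (hV : ∀ v ∈ V, ∃ w ∈ V, (Fin.cons 0 v : Fin (l + 1) → K) = Fin.snoc w 0) : V = ⊥ := by
  -- Induction on the distance `k` from the last coordinate: the hypothesis gives `v j = w (j + 1)`,
  -- and the last entry of `v` is the overflow, zero.
  have key : ∀ k : ℕ, ∀ v ∈ V, ∀ j : Fin l, (j : ℕ) + k + 1 = l → v j = 0 := by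
    intro k
    induction k with
    | zero =>
      intro v hv j hj
      obtain ⟨w, -, h⟩ := hV v hv
      have h' := congrFun h j.succ
      have hlast : j.succ = Fin.last l := by ext; simp; omega
      rwa [Fin.cons_succ, hlast, Fin.snoc_last] at h'
    | succ k ih =>
      intro v hv j hj
      obtain ⟨w, hw, h⟩ := hV v hv
      have h' := congrFun h j.succ
      have hcast : j.succ = Fin.castSucc (⟨j + 1, by omega⟩ : Fin l) := by ext; simp
      rw [Fin.cons_succ, hcast, Fin.snoc_castSucc] at h'
      rw [h']
      exact ih w hw _ (by simp; omega)
  rw [eq_bot_iff]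
  intro v hv
  rw [Submodule.mem_bot]
  ext j
  exact key (l - 1 - j) v hv j (by omega)

/-- Once the columns of a Hankel matrix are dependent, moving one row to the columns does not
increase the rank. -/
theorem rank_hankel_succ_le {b : ℕ → K} {k l : ℕ} (h : (hankel b (k + 1) l).rank < l) :
    (hankel b k (l + 1)).rank ≤ (hankel b (k + 1) l).rank := by
  by_contra! hlt
  have h1 := rank_hankel_add_finrank_ker b (k + 1) l
  have h2 := rank_hankel_add_finrank_ker b k (l + 1)
  set V := LinearMap.ker (hankel b (k + 1) l).mulVecLin
  set W := LinearMap.ker (hankel b k (l + 1)).mulVecLin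
  have hmap : Module.finrank K (V.map (snocZero K l)) = Module.finrank K V :=
    (Submodule.equivMapOfInjective _ (snocZero_injective l) V).finrank_eq.symm
  have hle : V.map (snocZero K l) ≤ W := by
    rintro _ ⟨v, hv, rfl⟩
    exact snocZero_mem_ker hv
  -- If the rank increases, the two rank-nullity identities give `dim W ≤ dim V`.
  have heq : V.map (snocZero K l) = W :=
    Submodule.eq_of_le_of_finrank_le hle (by omega)
  have hbot : V = ⊥ := eq_zero_of_shift_mem fun v hv => by
    have hc : (Fin.cons 0 v : Fin (l + 1) → K) ∈ W := cons_zero_mem_ker hv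
    rw [← heq] at hc
    obtain ⟨w, hw, hwv⟩ := hc
    exact ⟨w, hw, hwv.symm⟩
  rw [hbot, finrank_bot] at h1
  omega

end Hankel

/-! ### Combinatorics of the symmetric sequence -/

section Unimodal

/-- Numerical shape of a symmetric sequence that is nonincreasing from the first place where it
falls below its generic value. -/
theorem symmetric_sequence_shape {n : ℕ} {h : ℕ → ℕ} (hle : ∀ t, h t ≤ t + 1)
    (hsymm : ∀ t ≤ n, h t = h (n - t))
    (hstep : ∀ t < n, h t ≤ t → h (t + 1) ≤ h t) :
    (∀ t < h (n / 2), h t = t + 1) ∧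
      (∀ t ≤ n, h (n / 2) ≤ t + 1 → t + h (n / 2) ≤ n + 1 → h t = h (n / 2)) ∧
      ∀ t ≤ n, n + 1 ≤ t + h (n / 2) → h t = n + 1 - t := by
  have hanti : ∀ t, h t ≤ t → ∀ u, t + u ≤ n → h (t + u) ≤ h t := by
    intro t ht u
    induction u with
    | zero => intro _; exact le_rfl
    | succ u ih =>
      intro hu
      have h1 := ih (by omega)
      exact (hstep (t + u) (by omega) (by omega)).trans h1
  have hr := hle (n / 2)
  have hlow : ∀ t < h (n / 2), h t = t + 1 := by
    intro t ht
    by_contra hne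
    have h1 := hle t
    have h2 := hanti t (by omega) (n / 2 - t) (by omega)
    rw [show t + (n / 2 - t) = n / 2 by omega] at h2
    omega
  have hmid : ∀ t ≤ n, h (n / 2) ≤ t + 1 → t + h (n / 2) ≤ n + 1 → h t = h (n / 2) := by
    intro t htn ht hts
    -- Let `m` be the first deficient index. The values from `m` to `n - (m - 1)` are nonincreasing,
    -- start at most `m`, and end at `h (m - 1) = m` by symmetry, so all equal `m`.
    by_cases hex : ∃ m, m ≤ n / 2 ∧ h m ≤ m
    · classical
      obtain ⟨hm, hmm⟩ := Nat.find_spec hex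
      have hmin : ∀ u < Nat.find hex, h u = u + 1 := by
        intro u hu
        have h1 := Nat.find_min hex hu
        have h2 := hle u
        by_contra hne
        exact h1 ⟨by omega, by omega⟩
      generalize Nat.find hex = m at hm hmm hmin
      have hplateau : ∀ u, m ≤ u + 1 → u + m ≤ n + 1 → u ≤ n → h u = m := by
        intro u hu hum hun
        rcases Nat.eq_zero_or_pos m with rfl | hpos
        · have h1 := hanti 0 hmm u (by omega)
          rw [zero_add] at h1
          omega
        · have hfirst := hmin (m - 1) (by omega)
          have hlast := hsymm (m - 1) (by omega)
          rcases lt_or_ge u m with hlt | hge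
          · rw [hmin u hlt]; omega
          · have h1 := hanti m hmm (u - m) (by omega)
            rw [show m + (u - m) = u by omega] at h1
            have h2 := hanti u (by omega) (n - (m - 1) - u) (by omega)
            rw [show u + (n - (m - 1) - u) = n - (m - 1) by omega] at h2
            omega
      have hs := hplateau (n / 2) (by omega) (by omega) (by omega)
      rw [hs] at ht hts ⊢
      exact hplateau t ht hts htn
    -- With no deficiency up to the middle, the bounds leave only `t = n / 2` and its mirror image.
    · have h1 : h (n / 2) = n / 2 + 1 := by
        by_contra hne
        exact hex ⟨n / 2, le_rfl, by omega⟩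
      rcases eq_or_ne t (n / 2) with rfl | hne
      · rfl
      · rw [hsymm t (by omega), show n - t = n / 2 by omega]
  refine ⟨hlow, hmid, fun t ht hts => ?_⟩
  rw [hsymm t ht]
  rcases lt_or_ge (n - t) (h (n / 2)) with h1 | h1
  · rw [hlow _ h1]; omega
  -- This case is vacuous: `hts` forces `n - t < h (n / 2)`.
  · rw [hmid (n - t) (by omega) (by omega) (by omega)]
    have h2 := hle t
    omega

end Unimodal

/-! ### The binary form `ℓ ∘ F` -/

section Perazzo

open DividedPower

variable {K : Type*} [Field K] {d : ℕ}

/-- The exponent vector of `Y₁^p Y₂^q`. -/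
def binaryExponent (d p q : ℕ) : Var d →₀ ℕ :=
  Finsupp.single (Sum.inr 0) p + Finsupp.single (Sum.inr 1) q

@[simp] theorem binaryExponent_inl (p q : ℕ) (i : Fin d) :
    binaryExponent d p q (Sum.inl i) = 0 := by
  simp [binaryExponent]

@[simp] theorem binaryExponent_inr_zero (p q : ℕ) :
    binaryExponent d p q (Sum.inr 0) = p := by
  simp [binaryExponent]

@[simp] theorem binaryExponent_inr_one (p q : ℕ) :
    binaryExponent d p q (Sum.inr 1) = q := by
  simp [binaryExponent]

theorem binaryExponent_add (p q p' q' : ℕ) :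
    binaryExponent d p q + binaryExponent d p' q' = binaryExponent d (p + p') (q + q') := by
  simp only [binaryExponent, Finsupp.single_add]
  abel

theorem eq_binaryExponent {u : Var d →₀ ℕ} (h : ∀ i, u (Sum.inl i) = 0) :
    u = binaryExponent d (u (Sum.inr 0)) (u (Sum.inr 1)) := by
  ext (i | i)
  · simp [h]
  · fin_cases i <;> simp

theorem degree_eq (u : Var d →₀ ℕ) :
    u.degree = ∑ i, u (Sum.inl i) + (u (Sum.inr 0) + u (Sum.inr 1)) := by
  rw [Finsupp.degree_eq_sum, Fintype.sum_sum_type, Fin.sum_univ_two]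

/-- The coefficient sequence of a linear form, extended by zero. -/
def coeffSeq (a : Fin d → K) (i : ℕ) : K := if h : i < d then a ⟨i, h⟩ else 0

theorem hankelMatrix_eq_hankel (a : Fin d → K) (r : ℕ) :
    hankelMatrix a r = hankel (coeffSeq a) (d - r) (r + 1) := by
  ext i j
  have h : (i : ℕ) + (j : ℕ) < d := by omega
  simp [hankelMatrix, hankel, coeffSeq, h]

theorem coeff_monomial [DecidableEq (Var d →₀ ℕ)] (u v : Var d →₀ ℕ) :
    coeff v (DividedPower.monomial u : DividedPower (Var d) K) = if u = v then 1 else 0 :=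
  Finsupp.single_apply

/-- The coefficient of a divided power monomial as a linear functional. -/
def lcoeff {σ : Type*} (v : σ →₀ ℕ) : DividedPower σ K →ₗ[K] K where
  toFun := coeff v
  map_add' _ _ := rfl
  map_smul' _ _ := rfl

theorem lcoeff_apply {σ : Type*} (v : σ →₀ ℕ) (G : DividedPower σ K) :
    lcoeff v G = coeff v G := rfl

theorem X_smul_perazzoForm (i : Fin d) :
    (MvPolynomial.X (Sum.inl i) : MvPolynomial (Var d) K) • perazzoForm K d =
      DividedPower.monomial (binaryExponent d (d - 1 - i) i) := by
  rw [perazzoForm, Finset.smul_sum, Finset.sum_eq_single i]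
  · rw [X_smul_monomial, if_pos (by simp), add_assoc, add_tsub_cancel_left]
    rfl
  · intro j _ hj
    rw [X_smul_monomial, if_neg]
    simp [hj]
  · simp

theorem coeff_C_smul {σ : Type*} (v : σ →₀ ℕ) (c : K) (G : DividedPower σ K) :
    coeff v ((MvPolynomial.C c : MvPolynomial σ K) • G) = c * coeff v G := by
  rw [← MvPolynomial.monomial_zero', coeff_monomial_smul, zero_add]

theorem coeff_linearForm_smul_perazzoForm (a : Fin d → K) (v : Var d →₀ ℕ)
    [Decidable (∃ i : Fin d, v = binaryExponent d (d - 1 - i) i)] :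
    coeff v (linearForm a • perazzoForm K d) =
      if ∃ i : Fin d, v = binaryExponent d (d - 1 - i) i
        then coeffSeq a (v (Sum.inr 1)) else 0 := by
  classical
  rw [linearForm, Finset.sum_smul, ← lcoeff_apply, map_sum]
  simp only [mul_smul, X_smul_perazzoForm, lcoeff_apply, coeff_C_smul, coeff_monomial]
  split_ifs with h
  · obtain ⟨i, rfl⟩ := h
    rw [Finset.sum_eq_single i]
    · simp [coeffSeq]
    · intro j _ hj
      rw [if_neg, mul_zero]
      intro h
      have := DFunLike.congr_fun h (Sum.inr 1)
      simp only [binaryExponent_inr_one] at this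
      exact hj (Fin.ext this)
    · simp
  · refine Finset.sum_eq_zero fun i _ => ?_
    rw [if_neg, mul_zero]
    exact fun hi => h ⟨i, hi.symm⟩

theorem coeff_binaryExponent (a : Fin d → K) {p q : ℕ} (h : p + q + 1 = d) :
    coeff (binaryExponent d p q) (linearForm a • perazzoForm K d) = coeffSeq a q := by
  classical
  rw [coeff_linearForm_smul_perazzoForm, if_pos, binaryExponent_inr_one]
  exact ⟨⟨q, by omega⟩, by congr 1; simp; omega⟩

theorem exists_eq_of_coeff_ne_zero {a : Fin d → K} {v : Var d →₀ ℕ}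
    (h : coeff v (linearForm a • perazzoForm K d) ≠ 0) :
    ∃ p q, p + q + 1 = d ∧ v = binaryExponent d p q := by
  classical
  rw [coeff_linearForm_smul_perazzoForm] at h
  split_ifs at h with hv
  · obtain ⟨i, rfl⟩ := hv
    exact ⟨_, _, by omega, rfl⟩
  · exact absurd rfl h

/-! ### The Hilbert function as the dimension of `R_t ∘ G` -/

/-- The space `R_t ∘ G` of contractions of `G` by forms of degree `t`. -/
def contractions {σ : Type*} (G : DividedPower σ K) (t : ℕ) : Submodule K (DividedPower σ K) :=
  Submodule.span K
    ((fun u => (MvPolynomial.monomial u (1 : K)) • G) '' {u : σ →₀ ℕ | u.degree = t})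

theorem C_smul_eq {σ : Type*} (c : K) (G : DividedPower σ K) :
    (MvPolynomial.C c : MvPolynomial σ K) • G = c • G := by
  refine DividedPower.ext fun v => ?_
  rw [coeff_C_smul]
  rfl

/-- Evaluation at `G` of the contraction action. -/
def contractAt {σ : Type*} (G : DividedPower σ K) : MvPolynomial σ K →ₗ[K] DividedPower σ K where
  toFun f := f • G
  map_add' f g := add_smul f g G
  map_smul' c f := by
    rw [MvPolynomial.smul_eq_C_mul, mul_smul, C_smul_eq]
    rfl

theorem homogeneousSubmodule_eq_span {σ : Type*} (t : ℕ) :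
    MvPolynomial.homogeneousSubmodule σ K t = Submodule.span K
      ((fun u => MvPolynomial.monomial u (1 : K)) '' {u : σ →₀ ℕ | u.degree = t}) := by
  apply le_antisymm
  · intro f hf
    rw [f.as_sum]
    refine Submodule.sum_mem _ fun u hu => ?_
    rw [← mul_one (MvPolynomial.coeff u f), ← smul_eq_mul, ← MvPolynomial.smul_monomial]
    refine Submodule.smul_mem _ _ (Submodule.subset_span ⟨u, ?_, rfl⟩)
    have := hf (MvPolynomial.mem_support_iff.1 hu)
    rwa [Set.mem_ofPred_eq, Finsupp.degree_eq_weight_one]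
  · rw [Submodule.span_le]
    rintro _ ⟨u, hu, rfl⟩
    exact MvPolynomial.isHomogeneous_monomial _ hu

theorem map_contractAt {σ : Type*} (G : DividedPower σ K) (t : ℕ) :
    (MvPolynomial.homogeneousSubmodule σ K t).map (contractAt G) = contractions G t := by
  rw [homogeneousSubmodule_eq_span, Submodule.map_span, ← Set.image_comp]
  rfl

/-- The map `f ↦ f ∘ G` has kernel `Ann_R(G)`, so it embeds `A_G` in `S` and carries the degree `t`
piece onto `R_t ∘ G`. -/
theorem hilbertFunction_eq_finrank {σ : Type*} (G : DividedPower σ K) (t : ℕ) :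
    hilbertFunction G t = Module.finrank K (contractions G t) := by
  let I := Ideal.torsionOf (MvPolynomial σ K) (DividedPower σ K) G
  let ψ : MacaulayAlgebra G →ₗ[K] DividedPower σ K :=
    (Submodule.liftQ (I.restrictScalars K) (contractAt G) fun f hf => hf)
  have hψ : Function.Injective ψ := by
    rw [← LinearMap.ker_eq_bot]
    exact Submodule.ker_liftQ_eq_bot _ _ _ fun f hf => hf
  have hmap : (gradedPiece G t).map ψ = contractions G t := by
    rw [← map_contractAt, gradedPiece, ← Submodule.map_comp]
    rfl
  rw [hilbertFunction, ← hmap]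
  exact (Submodule.equivMapOfInjective ψ hψ _).finrank_eq

/-! ### Contractions of `ℓ ∘ F` as Hankel column spaces -/

/-- The coefficients of a form of degree `k - 1` in the variables `Y₁, Y₂`. -/
def binaryCoeffs (d k : ℕ) : DividedPower (Var d) K →ₗ[K] (Fin k → K) :=
  LinearMap.pi fun i => lcoeff (binaryExponent d (k - 1 - i) i)

theorem binaryCoeffs_apply {k : ℕ} (G : DividedPower (Var d) K) (i : Fin k) :
    binaryCoeffs d k G i = coeff (binaryExponent d (k - 1 - i) i) G := rfl

theorem binaryCoeffs_monomial_smul (a : Fin d → K) {p q t : ℕ} (h : p + q = t)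
    (i : Fin (d - t)) :
    binaryCoeffs d (d - t) (MvPolynomial.monomial (binaryExponent d p q) (1 : K) •
      linearForm a • perazzoForm K d) i = coeffSeq a (i + q) := by
  rw [binaryCoeffs_apply, coeff_monomial_smul, one_mul, binaryExponent_add,
    coeff_binaryExponent a (by omega), add_comm]

theorem monomial_smul_eq_zero (a : Fin d → K) {u : Var d →₀ ℕ} {i : Fin d}
    (h : u (Sum.inl i) ≠ 0) :
    MvPolynomial.monomial u (1 : K) • linearForm a • perazzoForm K d = 0 := by
  refine DividedPower.ext fun v => ?_
  rw [coeff_monomial_smul, one_mul]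
  change _ = (0 : K)
  by_contra hne
  obtain ⟨p, q, -, hpq⟩ := exists_eq_of_coeff_ne_zero hne
  have := DFunLike.congr_fun hpq (Sum.inl i)
  rw [binaryExponent_inl, Finsupp.add_apply] at this
  omega

/-- Contraction by degree `t` leaves only binary monomials of degree `d - 1 - t`; this makes
`binaryCoeffs` injective on `R_t ∘ (ℓ ∘ F)`. -/
theorem coeff_eq_zero_of_mem_contractions {a : Fin d → K} {t : ℕ} {G : DividedPower (Var d) K}
    (hG : G ∈ contractions (linearForm a • perazzoForm K d) t) {v : Var d →₀ ℕ}
    (hv : ∀ i : Fin (d - t), v ≠ binaryExponent d (d - t - 1 - i) i) : coeff v G = 0 := by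
  have hle : contractions (linearForm a • perazzoForm K d) t ≤ LinearMap.ker (lcoeff v) := by
    rw [contractions, Submodule.span_le]
    rintro _ ⟨u, hu, rfl⟩
    change coeff v _ = 0
    rw [coeff_monomial_smul, one_mul]
    by_contra hne
    obtain ⟨p, q, hd, hpq⟩ := exists_eq_of_coeff_ne_zero hne
    have h0 := DFunLike.congr_fun hpq (Sum.inr 0)
    have h1 := DFunLike.congr_fun hpq (Sum.inr 1)
    have hl : ∀ i, u (Sum.inl i) + v (Sum.inl i) = 0 := fun i => by
      have := DFunLike.congr_fun hpq (Sum.inl i)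
      simpa using this
    simp only [Finsupp.add_apply, binaryExponent_inr_zero, binaryExponent_inr_one] at h0 h1
    have hu' : u.degree = t := hu
    rw [degree_eq, Finset.sum_eq_zero fun i _ => (Nat.add_eq_zero_iff.1 (hl i)).1] at hu'
    refine hv ⟨v (Sum.inr 1), by omega⟩ ?_
    refine (eq_binaryExponent fun i => (Nat.add_eq_zero_iff.1 (hl i)).2).trans ?_
    congr 1
    simp only
    omega
  exact hle hG

/-- Column `q` is the coefficient vector of `y₁^(t-q) y₂^q ∘ (ℓ ∘ F)`, while monomials involving
some `x_i` contribute zero. -/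
theorem map_binaryCoeffs_contractions (a : Fin d → K) (t : ℕ) :
    (contractions (linearForm a • perazzoForm K d) t).map (binaryCoeffs d (d - t)) =
      LinearMap.range (hankel (coeffSeq a) (d - t) (t + 1)).mulVecLin := by
  rcases le_or_gt d t with hdt | hdt
  · have : IsEmpty (Fin (d - t)) := by
      rw [Nat.sub_eq_zero_of_le hdt]
      infer_instance
    exact Subsingleton.elim _ _
  rw [Matrix.range_mulVecLin, contractions, Submodule.map_span]
  apply le_antisymm <;> rw [Submodule.span_le]
  · rintro _ ⟨_, ⟨u, hu, rfl⟩, rfl⟩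
    by_cases h : ∀ i, u (Sum.inl i) = 0
    · have hu' : u.degree = t := hu
      rw [degree_eq, Finset.sum_eq_zero fun i _ => h i, zero_add] at hu'
      refine Submodule.subset_span ⟨⟨u (Sum.inr 1), by omega⟩, ?_⟩
      ext i
      dsimp only
      conv_rhs => rw [eq_binaryExponent h]
      exact (binaryCoeffs_monomial_smul a hu' i).symm
    · push Not at h
      obtain ⟨i, hi⟩ := h
      dsimp only
      rw [monomial_smul_eq_zero a hi, map_zero]
      exact Submodule.zero_mem _
  · rintro _ ⟨j, rfl⟩
    obtain ⟨p, hp⟩ : ∃ p, p + (j : ℕ) = t := ⟨t - j, by omega⟩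
    refine Submodule.subset_span
      ⟨_, ⟨binaryExponent d p j, ?_, rfl⟩, ?_⟩
    · simp [degree_eq, hp]
    · ext i
      exact binaryCoeffs_monomial_smul a hp i

theorem hilbertFunction_eq_rank_hankel (a : Fin d → K) (t : ℕ) :
    hilbertFunction (linearForm a • perazzoForm K d) t =
      (hankel (coeffSeq a) (d - t) (t + 1)).rank := by
  rw [hilbertFunction_eq_finrank, Matrix.rank, ← map_binaryCoeffs_contractions,
    ← LinearMap.range_domRestrict]
  refine (LinearMap.finrank_range_of_inj ?_).symm
  rw [injective_iff_map_eq_zero]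
  rintro ⟨G, hG⟩ h
  rw [Submodule.mk_eq_zero]
  refine DividedPower.ext fun v => ?_
  change _ = (0 : K)
  by_cases hv : ∃ i : Fin (d - t), v = binaryExponent d (d - t - 1 - i) i
  · obtain ⟨i, rfl⟩ := hv
    exact congrFun h i
  · exact coeff_eq_zero_of_mem_contractions hG fun i hi => hv ⟨i, hi⟩

end Perazzo

end PerazzoJordan

end

theorem mainTheorem4 {K : Type*} [Field K] (d : ℕ) (hd : 3 ≤ d) (a : Fin d → K) (s : ℕ)
    (hs : s = (PerazzoJordan.hankelMatrix a ((d - 1) / 2)).rank) :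
    (∀ t : ℕ, t < s →
      PerazzoJordan.hilbertFunction
        (PerazzoJordan.linearForm a • PerazzoJordan.perazzoForm K d) t = t + 1) ∧
    (∀ t : ℕ, s ≤ t + 1 → t + s ≤ d →
      PerazzoJordan.hilbertFunction
        (PerazzoJordan.linearForm a • PerazzoJordan.perazzoForm K d) t = s) ∧
    (∀ t : ℕ, t < d → d ≤ t + s →
      PerazzoJordan.hilbertFunction
        (PerazzoJordan.linearForm a • PerazzoJordan.perazzoForm K d) t = d - t) ∧
    (∀ t : ℕ, d ≤ t →
      PerazzoJordan.hilbertFunction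
        (PerazzoJordan.linearForm a • PerazzoJordan.perazzoForm K d) t = 0) := by
  have h_rank := fun t => PerazzoJordan.hilbertFunction_eq_rank_hankel a t
  set h := PerazzoJordan.hilbertFunction
    (PerazzoJordan.linearForm a • PerazzoJordan.perazzoForm K d)
  have hs' : s = h ((d - 1) / 2) := by
    rw [hs, PerazzoJordan.hankelMatrix_eq_hankel, h_rank]
  have hle : ∀ t, h t ≤ t + 1 := fun t => by
    rw [h_rank]
    exact Matrix.rank_le_width _
  have hheight : ∀ t, h t ≤ d - t := fun t => by
    rw [h_rank]
    exact Matrix.rank_le_height _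
  -- Replacing `t` by `d - 1 - t` exchanges the two sizes `d - t` and `t + 1`.
  have hsymm : ∀ t ≤ d - 1, h t = h (d - 1 - t) := fun t ht => by
    rw [h_rank, h_rank, PerazzoJordan.rank_hankel_comm]
    congr 2 <;> omega
  have hstep : ∀ t < d - 1, h t ≤ t → h (t + 1) ≤ h t := fun t ht hlt => by
    rw [h_rank] at hlt ⊢
    rw [h_rank]
    rw [show d - t = d - (t + 1) + 1 by omega] at hlt ⊢
    exact PerazzoJordan.rank_hankel_succ_le (by omega)
  obtain ⟨h1, h2, h3⟩ := PerazzoJordan.symmetric_sequence_shape hle hsymm hstep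
  rw [← hs'] at h1 h2 h3
  refine ⟨h1, fun t ht hts => ?_, fun t ht hts => ?_, fun t ht => ?_⟩
  -- The range `t + s ≤ d` also admits `t = d` when `s = 0`, where the row bound gives zero.
  · rcases lt_or_ge t d with htd | htd
    · exact h2 t (by omega) ht (by omega)
    · have := hheight t
      omega
  · rw [h3 t (by omega) (by omega)]
    omega
  · have := hheight t
    omega
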